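/- Let $\Gamma$ be a group and let $X\subset\Gamma$ be a finite set that generates $\Gamma$. Let $\mathbb F_X$ be the free group on $X$, let $\pi_X:\mathbb F_X\to\Gamma$ be the canonical epimorphism, and let $B_n\subset\mathbb F_X$ be the ball of radius $n$ around the identity for the word length, i.e. the set of elements whose reduced word has at most $n$ letters. A set $S\subset\mathbb F_X$ is *upper Banach generic* (UB-generic) if $$\limsup_{n\to\infty}\ \max_{\omega\in\mathbb F_X}\frac{|S\cap\omega B_n|}{|B_n|}=1 .$$ The group $\Gamma$ has *solvable word problem on* $S\subset\mathbb F_X$ if there is a partial algorithm, taking reduced words over $X\cup X^{-1}$ (elements of $\mathbb F_X$) as inputs, that halts at least on every $\omega\in S$ and that, whenever it halts on an input $\omega\in\mathbb F_X$ (in $S$ or not), correctly answers whether $\omega\in\ker\pi_X$. The group $\Gamma$ has *solvable UB-generic word problem with respect to* $X$ if it has solvable word problem on some UB-generic subset of $\mathbb F_X$. **Statement.** If $\Gamma$ has solvable UB-generic word problem with respect to some finite generating set $X$, then $\Gamma$ has solvable UB-generic word problem with respect to every finite generating set $Y$ of $\Gamma$. -/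

import Mathlib

open scoped Pointwise

noncomputable section

namespace UBGen

/-- The word length on the free group on `A`: the number of letters of the reduced word. -/
def wordLength {A : Type*} (ω : FreeGroup A) : ℕ :=
  letI : DecidableEq A := Classical.decEq A
  FreeGroup.norm ω

/-- The ball `B_n` of radius `n` around the identity of the free group on `A`. -/
def ball (A : Type*) (n : ℕ) : Set (FreeGroup A) := {ω | wordLength ω ≤ n}

/-- The upper Banach density of a subset `S` of the free group on the finite alphabet `A`:
`limsup_n  max_ω |S ∩ ω B_n| / |B_n|`.
The quotients lie in `[0, 1]` and, for fixed `n`, take finitely many values,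
so the supremum over `ω` is a maximum. -/
def upperBanachDensity {A : Type*} [Finite A] (S : Set (FreeGroup A)) : ℝ :=
  Filter.limsup
    (fun n : ℕ => ⨆ ω : FreeGroup A,
      ((S ∩ ω • ball A n).ncard : ℝ) / ((ball A n).ncard : ℝ))
    Filter.atTop

/-- Upper Banach generic subsets of a free group of finite rank. -/
def IsUBGeneric {A : Type*} [Finite A] (S : Set (FreeGroup A)) : Prop :=
  upperBanachDensity S = 1

/-- The reduced word of `ω`, with its letters renamed along `e`; the Boolean attached to a letter
is `true` for a generator and `false` for the inverse of a generator.
This is the form in which elements of the free group are handed to an algorithm. -/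
def code {A : Type*} {d : ℕ} (e : A ≃ Fin d) (ω : FreeGroup A) : List (Fin d × Bool) :=
  letI : DecidableEq A := Classical.decEq A
  (FreeGroup.toWord ω).map (Prod.map e id)

variable {Γ : Type*} [Group Γ]

/-- The canonical homomorphism from the free group on `X` to `Γ`; it is onto when `X` generates. -/
def proj (X : Finset Γ) : FreeGroup X →* Γ := FreeGroup.lift (fun x : X => (x : Γ))

/-- The word problem with respect to `X` is solvable on the set `S` of reduced words: there is a
partial algorithm that halts at least on all elements of `S` and that, whenever it halts on an
element of the free group (in `S` or not), decides correctly whether this element is trivial in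
the group. The letters are numbered by some bijection `e`; which one does not matter, because any
two differ by a permutation of a finite alphabet. -/
def SolvableWPOn (X : Finset Γ) (S : Set (FreeGroup X)) : Prop :=
  ∃ (e : X ≃ Fin X.card) (f : List (Fin X.card × Bool) →. Bool), Partrec f ∧
    (∀ ω ∈ S, (f (code e ω)).Dom) ∧
    ∀ ω : FreeGroup X, ∀ b ∈ f (code e ω), (b = true ↔ ω ∈ (proj X).ker)

/-- Solvability of the upper Banach generic word problem with respect to `X`. -/
def SolvableUBGenericWP (X : Finset Γ) : Prop :=
  ∃ S : Set (FreeGroup X), IsUBGeneric S ∧ SolvableWPOn X S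

end UBGen

end

/-! A set is UB-generic exactly when it contains a translate of every ball
(`isUBGeneric_of_forall_ball`, `IsUBGeneric.exists_ball_subset`). Choose homomorphisms `φ : F_Y →
F_X` and `ψ : F_X → F_Y` over `Γ`. For every `w` in `F_X`, the map `v ↦ w φ(ψ(w)⁻¹ v)` preserves
images in `Γ`, so any answer of the `X`-algorithm on its value is correct for `v`. It sends `ψ(w)
B_n` into `w B_{Cn}`, where `C` bounds the stretching of `φ`. Running the algorithm on all `w` in
parallel therefore halts on a translate of each `B_n`. -/

namespace UBGen

/-! ### Word length and balls in free groups -/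

section Balls

variable {A : Type*}

theorem wordLength_mul_le (u v : FreeGroup A) :
    wordLength (u * v) ≤ wordLength u + wordLength v :=
  letI : DecidableEq A := Classical.decEq A
  FreeGroup.norm_mul_le u v

theorem wordLength_inv (u : FreeGroup A) : wordLength u⁻¹ = wordLength u :=
  letI : DecidableEq A := Classical.decEq A
  FreeGroup.norm_inv_eq

theorem wordLength_mk_le (L : List (A × Bool)) : wordLength (FreeGroup.mk L) ≤ L.length :=
  letI : DecidableEq A := Classical.decEq A
  FreeGroup.norm_mk_le

theorem exists_mk_eq_length_eq (u : FreeGroup A) :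
    ∃ L : List (A × Bool), FreeGroup.mk L = u ∧ L.length = wordLength u :=
  letI : DecidableEq A := Classical.decEq A
  ⟨u.toWord, FreeGroup.mk_toWord, rfl⟩

theorem one_mem_ball (n : ℕ) : (1 : FreeGroup A) ∈ ball A n :=
  (wordLength_mk_le ([] : List (A × Bool))).trans (Nat.zero_le n)

theorem ball_inv (n : ℕ) : (ball A n)⁻¹ = ball A n := by
  ext u
  simp [ball, wordLength_inv]

theorem finite_ball [Finite A] (n : ℕ) : (ball A n).Finite := by
  refine ((List.finite_length_le (A × Bool) n).image FreeGroup.mk).subset fun u hu => ?_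
  obtain ⟨L, rfl, hL⟩ := exists_mk_eq_length_eq u
  exact ⟨L, hL.trans_le hu, rfl⟩

theorem ncard_ball_pos [Finite A] (n : ℕ) : 0 < (ball A n).ncard :=
  (Set.ncard_pos (finite_ball n)).2 ⟨1, one_mem_ball n⟩

theorem ncard_smul_ball (ω : FreeGroup A) (n : ℕ) : (ω • ball A n).ncard = (ball A n).ncard :=
  Set.ncard_image_of_injective _ (MulAction.injective ω)

theorem ball_add_subset (m n : ℕ) : ball A (m + n) ⊆ ball A m * ball A n := by
  intro u hu
  obtain ⟨L, rfl, hL⟩ := exists_mk_eq_length_eq u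
  have hL' : L.length ≤ m + n := hL.trans_le hu
  refine ⟨FreeGroup.mk (L.take m), ?_, FreeGroup.mk (L.drop m), ?_, ?_⟩
  · exact (wordLength_mk_le _).trans (by simp)
  · exact (wordLength_mk_le _).trans (by simp; omega)
  · simp [FreeGroup.mul_mk]

theorem ncard_mul_le {G : Type*} [Group G] (s t : Set G) :
    (s * t).ncard ≤ s.ncard * t.ncard := by
  simpa only [_root_.Nat.card_coe_set_eq] using Set.natCard_mul_le (s := s) (t := t)

theorem wordLength_map_le [Finite A] {B : Type*} (h : FreeGroup A →* FreeGroup B) :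
    ∃ C : ℕ, ∀ u, wordLength (h u) ≤ C * wordLength u := by
  obtain ⟨C, hC⟩ := (Set.finite_range fun p : A × Bool => wordLength (h (FreeGroup.mk [p]))).bddAbove
  refine ⟨C, fun u => ?_⟩
  obtain ⟨L, rfl, hL⟩ := exists_mk_eq_length_eq u
  rw [← hL]
  clear hL
  induction L with
  | nil =>
    rw [← FreeGroup.one_eq_mk, map_one]
    exact wordLength_mk_le ([] : List (B × Bool))
  | cons p L ih =>
    rw [← List.singleton_append, ← FreeGroup.mul_mk, map_mul]
    have hp : wordLength (h (FreeGroup.mk [p])) ≤ C := hC ⟨p, rfl⟩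
    refine (wordLength_mul_le _ _).trans ?_
    simp only [List.singleton_append, List.length_cons]
    linarith

end Balls

/-! ### UB-genericity and translates of balls -/

section Generic

variable {A : Type*} [Finite A] {S : Set (FreeGroup A)}

theorem finite_smul_ball (ω : FreeGroup A) (n : ℕ) : (ω • ball A n).Finite :=
  (finite_ball n).image _

theorem density_le_one (S : Set (FreeGroup A)) (ω : FreeGroup A) (n : ℕ) :
    ((S ∩ ω • ball A n).ncard : ℝ) / ((ball A n).ncard : ℝ) ≤ 1 := by
  refine div_le_one_of_le₀ ?_ (Nat.cast_nonneg _)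
  rw [← ncard_smul_ball ω n]
  exact_mod_cast Set.ncard_le_ncard Set.inter_subset_right (finite_smul_ball ω n)

theorem isUBGeneric_of_forall_ball (hS : ∀ n, ∃ ω : FreeGroup A, ω • ball A n ⊆ S) :
    IsUBGeneric S := by
  have key : ∀ n, (⨆ ω : FreeGroup A,
      ((S ∩ ω • ball A n).ncard : ℝ) / ((ball A n).ncard : ℝ)) = 1 := by
    intro n
    refine le_antisymm (ciSup_le fun ω => density_le_one S ω n) ?_
    obtain ⟨ω, hω⟩ := hS n
    refine le_trans (le_of_eq ?_)
      (le_ciSup ⟨1, Set.forall_mem_range.2 fun ω => density_le_one S ω n⟩ ω)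
    rw [Set.inter_eq_right.2 hω, ncard_smul_ball, div_self]
    exact_mod_cast (ncard_ball_pos n).ne'
  simp [IsUBGeneric, upperBanachDensity, key]

/-- If no translate of the ball of radius `r` lies in `S`, then `S` misses a fixed proportion of
every translate of a larger ball. -/
theorem ncard_ball_le_of_forall_not_subset {r : ℕ}
    (h : ∀ ω : FreeGroup A, ¬ ω • ball A r ⊆ S) {n : ℕ} (hn : r ≤ n) (ω : FreeGroup A) :
    (ball A n).ncard ≤ (ω • ball A n \ S).ncard * (ball A r).ncard ^ 2 := by
  obtain ⟨m, rfl⟩ := Nat.exists_eq_add_of_le' hn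
  -- Each point of `ω B_m` lies within distance `r` of a point outside `S`, and that point is still
  -- in `ω B_{m+r}`.
  have hsub : ω • ball A m ⊆ (ω • ball A (m + r) \ S) * ball A r := by
    rintro _ ⟨u, hu, rfl⟩
    obtain ⟨_, ⟨b, hb, rfl⟩, hbS⟩ := Set.not_subset.1 (h (ω * u))
    refine ⟨_, ⟨⟨u * b, ?_, rfl⟩, ?_⟩, b⁻¹, ?_, ?_⟩
    · exact (wordLength_mul_le u b).trans (add_le_add hu hb)
    · simpa [mul_assoc] using hbS
    · rwa [← Set.mem_inv, ball_inv]
    · simp [mul_assoc]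
  have h₁ : (ball A m).ncard ≤ (ω • ball A (m + r) \ S).ncard * (ball A r).ncard := by
    rw [← ncard_smul_ball ω m]
    exact (Set.ncard_le_ncard hsub ((finite_smul_ball ω _).sdiff.mul (finite_ball r))).trans
      (ncard_mul_le _ _)
  have h₂ : (ball A (m + r)).ncard ≤ (ball A m).ncard * (ball A r).ncard :=
    (Set.ncard_le_ncard (ball_add_subset m r) ((finite_ball m).mul (finite_ball r))).trans
      (ncard_mul_le _ _)
  calc (ball A (m + r)).ncard ≤ (ball A m).ncard * (ball A r).ncard := h₂
    _ ≤ (ω • ball A (m + r) \ S).ncard * (ball A r).ncard * (ball A r).ncard :=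
        Nat.mul_le_mul_right _ h₁
    _ = _ := by ring

/-- Otherwise every translate of a large ball misses `S` in a proportion at least `1 / |B_r|²`,
independent of `n`, which keeps the limsup below 1. -/
theorem IsUBGeneric.exists_ball_subset (hS : IsUBGeneric S) (r : ℕ) :
    ∃ ω : FreeGroup A, ω • ball A r ⊆ S := by
  by_contra! h
  obtain ⟨b, hb⟩ : ∃ b : ℝ, b = (ball A r).ncard := ⟨_, rfl⟩
  have hb0 : 0 < b := by rw [hb]; exact_mod_cast ncard_ball_pos (A := A) r
  have hle : ∀ n, r ≤ n → (⨆ ω : FreeGroup A,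
      ((S ∩ ω • ball A n).ncard : ℝ) / ((ball A n).ncard : ℝ)) ≤ 1 - 1 / b ^ 2 := by
    intro n hn
    refine ciSup_le fun ω => ?_
    have hpos : (0 : ℝ) < (ball A n).ncard := by exact_mod_cast ncard_ball_pos (A := A) n
    have h₁ : ((ball A n).ncard : ℝ) ≤ (ω • ball A n \ S).ncard * b ^ 2 := by
      rw [hb]
      exact_mod_cast ncard_ball_le_of_forall_not_subset h hn ω
    have h₂ : ((S ∩ ω • ball A n).ncard : ℝ) + (ω • ball A n \ S).ncard = (ball A n).ncard := by
      rw [Set.inter_comm, ← ncard_smul_ball ω n]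
      exact_mod_cast Set.ncard_inter_add_ncard_sdiff_eq_ncard _ _ (finite_smul_ball ω n)
    have h₃ : ((ball A n).ncard : ℝ) / b ^ 2 ≤ (ω • ball A n \ S).ncard :=
      (div_le_iff₀ (by positivity)).2 h₁
    rw [div_le_iff₀ hpos, sub_mul, one_mul, one_div_mul_eq_div]
    linarith
  have hlim : upperBanachDensity S ≤ 1 - 1 / b ^ 2 := by
    refine Filter.limsup_le_of_le ?_ (Filter.eventually_atTop.2 ⟨r, hle⟩)
    refine Filter.IsCoboundedUnder.of_frequently_ge (a := 0) (Filter.Frequently.of_forall fun n => ?_)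
    exact Real.iSup_nonneg fun ω => by positivity
  have : upperBanachDensity S = 1 := hS
  have : 0 < 1 / b ^ 2 := by positivity
  linarith

end Generic

/-! ### Computability of free group operations on codes -/

section Coding

variable {A : Type*} {d : ℕ}

/-- The element of the free group named by a word in the numbered letters. -/
def word (e : A ≃ Fin d) (L : List (Fin d × Bool)) : FreeGroup A :=
  FreeGroup.mk (L.map (Prod.map e.symm id))

theorem word_code (e : A ≃ Fin d) (ω : FreeGroup A) : word e (code e ω) = ω := by
  let _ : DecidableEq A := Classical.decEq A
  simp [word, code, Function.comp_def, Prod.map, FreeGroup.mk_toWord]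

theorem code_word (e : A ≃ Fin d) (L : List (Fin d × Bool)) :
    code e (word e L) = FreeGroup.reduce L := by
  let _ : DecidableEq A := Classical.decEq A
  have hred : FreeGroup.IsReduced (code e (word e L)) := by
    have := FreeGroup.isReduced_toWord (x := word e L)
    simpa [code, FreeGroup.IsReduced, List.isChain_map] using this
  have hmk : FreeGroup.mk (code e (word e L)) = FreeGroup.mk L := by
    have h : FreeGroup.mk (code e (word e L)) = FreeGroup.map e (word e L) := by
      conv_rhs => rw [← FreeGroup.mk_toWord (x := word e L), FreeGroup.map.mk]
      rfl
    rw [h]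
    simp [word, FreeGroup.map.mk, Function.comp_def]
  rw [← hred.reduce_eq]
  exact FreeGroup.reduce.sound hmk

theorem word_append (e : A ≃ Fin d) (L M : List (Fin d × Bool)) :
    word e (L ++ M) = word e L * word e M := by
  simp [word, FreeGroup.mul_mk]

theorem word_invRev (e : A ≃ Fin d) (L : List (Fin d × Bool)) :
    word e (FreeGroup.invRev L) = (word e L)⁻¹ := by
  simp [word, FreeGroup.inv_mk, FreeGroup.invRev, Function.comp_def]

theorem primrec_reduce (d : ℕ) :
    Primrec (FreeGroup.reduce : List (Fin d × Bool) → List (Fin d × Bool)) := by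
  -- Reduction is a right fold: prepend a letter to a reduced word, cancelling it if it is inverse
  -- to the head.
  let step : (Fin d × Bool) × List (Fin d × Bool) → List (Fin d × Bool) := fun p =>
    List.casesOn p.2 [p.1] fun hd tl =>
      if p.1.1 = hd.1 ∧ p.1.2 = !hd.2 then tl else p.1 :: hd :: tl
  have hstep : Primrec step := by
    refine Primrec.list_casesOn
      (f := fun p : (Fin d × Bool) × List (Fin d × Bool) => p.2)
      (h := fun p q => if p.1.1 = q.1.1 ∧ p.1.2 = !q.1.2 then q.2 else p.1 :: q.1 :: q.2)
      Primrec.snd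
      (Primrec.list_cons.comp Primrec.fst (Primrec.const ([] : List (Fin d × Bool)))) ?_
    have hx : Primrec fun q : ((Fin d × Bool) × List (Fin d × Bool)) ×
        ((Fin d × Bool) × List (Fin d × Bool)) => q.1.1 := Primrec.fst.comp Primrec.fst
    have hhd : Primrec fun q : ((Fin d × Bool) × List (Fin d × Bool)) ×
        ((Fin d × Bool) × List (Fin d × Bool)) => q.2.1 := Primrec.fst.comp Primrec.snd
    have htl : Primrec fun q : ((Fin d × Bool) × List (Fin d × Bool)) ×
        ((Fin d × Bool) × List (Fin d × Bool)) => q.2.2 := Primrec.snd.comp Primrec.snd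
    refine Primrec.ite (PrimrecPred.and ?_ ?_) htl
      (Primrec.list_cons.comp hx (Primrec.list_cons.comp hhd htl))
    · exact Primrec.eq.comp (Primrec.fst.comp hx) (Primrec.fst.comp hhd)
    · exact Primrec.eq.comp (Primrec.snd.comp hx) (Primrec.not.comp (Primrec.snd.comp hhd))
  refine (Primrec.list_foldr (h := fun _ p => step p) Primrec.id
    (Primrec.const ([] : List (Fin d × Bool)))
    (hstep.comp Primrec.snd).to₂).of_eq ?_
  intro L
  induction L with
  | nil => rfl
  | cons x L ih =>
    rw [FreeGroup.reduce.cons, ← ih]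
    rfl

/-- A homomorphism is computed by substituting for letters from a finite table and then reducing; no
effectivity of `h` is needed. -/
theorem primrec_code_map {B : Type*} {d' : ℕ} (e : A ≃ Fin d) (e' : B ≃ Fin d')
    (h : FreeGroup A →* FreeGroup B) : Primrec fun L => code e' (h (word e L)) := by
  refine ((primrec_reduce d').comp (Primrec.list_flatMap Primrec.id
    ((Primrec.dom_finite fun p => code e' (h (word e [p]))).comp Primrec.snd).to₂)).of_eq ?_
  intro L
  rw [← code_word e']
  congr 1
  induction L with
  | nil => simp [word, ← FreeGroup.one_eq_mk]
  | cons p L ih =>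
    simp only [id_eq] at ih ⊢
    rw [List.flatMap_cons, word_append, ih, word_code, ← map_mul, ← word_append,
      List.singleton_append]

theorem primrec_code_mul (e : A ≃ Fin d) :
    Primrec₂ fun L M => code e (word e L * word e M) :=
  ((primrec_reduce d).comp₂ Primrec.list_append).of_eq fun L M => by
    rw [← word_append, code_word]

theorem primrec_code_inv (e : A ≃ Fin d) : Primrec fun L => code e (word e L)⁻¹ :=
  ((primrec_reduce d).comp (Primrec.list_reverse.comp (Primrec.list_map Primrec.id
    ((Primrec.dom_finite fun p : Fin d × Bool => (p.1, !p.2)).comp Primrec.snd).to₂))).of_eq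
    fun L => by rw [← word_invRev, code_word]; rfl

end Coding

/-- Dovetailing: a partial recursive function may be run in parallel on all values of a
parameter, and the first answer returned. -/
theorem exists_partrec_dovetail {α β σ : Type*} [Primcodable α] [Primcodable β] [Primcodable σ]
    {f : α × β →. σ} (hf : Partrec f) :
    ∃ F : β →. σ, Partrec F ∧ (∀ b, ∀ s ∈ F b, ∃ a, s ∈ f (a, b)) ∧
      ∀ a b, (f (a, b)).Dom → (F b).Dom := by
  obtain ⟨c, hc⟩ := Nat.Partrec.Code.exists_code.1 hf
  have hmem : ∀ a b s, s ∈ f (a, b) ↔ Encodable.encode s ∈ c.eval (Encodable.encode (a, b)) := by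
    intro a b s
    simp [hc]
  -- The search index `n` encodes a pair: a candidate parameter and a bound for the evaluation.
  let step : β → ℕ → Option σ := fun b n =>
    (Encodable.decode (α := α) n.unpair.1).bind fun a =>
      (Nat.Partrec.Code.evaln n.unpair.2 c (Encodable.encode (a, b))).bind Encodable.decode
  have hstep : Primrec₂ step := by
    refine Primrec.option_bind
      (Primrec.decode.comp (Primrec.fst.comp (Primrec.unpair.comp Primrec.snd))) ?_
    refine Primrec.option_bind (Nat.Partrec.Code.primrec_evaln.comp
      (Primrec.pair (Primrec.pair ?_ (Primrec.const c)) ?_)) (Primrec.decode.comp Primrec.snd).to₂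
    · exact Primrec.snd.comp (Primrec.unpair.comp (Primrec.snd.comp Primrec.fst))
    · exact Primrec.encode.comp (Primrec.pair Primrec.snd (Primrec.fst.comp Primrec.fst))
  refine ⟨fun b => Nat.rfindOpt (step b), Partrec.rfindOpt hstep.to_comp, ?_, ?_⟩
  · intro b s hs
    obtain ⟨n, hn⟩ := Nat.rfindOpt_spec hs
    simp only [step, Option.mem_def, Option.bind_eq_some_iff] at hn
    obtain ⟨a, -, m, hm, hms⟩ := hn
    have hm' := Nat.Partrec.Code.evaln_sound hm
    rw [hc] at hm'
    simp only [Encodable.encodek, Part.coe_some, Part.bind_some, Part.mem_map_iff] at hm'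
    obtain ⟨t, ht, rfl⟩ := hm'
    rw [Encodable.encodek, Option.some_inj] at hms
    exact ⟨a, hms ▸ ht⟩
  · intro a b hab
    obtain ⟨s, hs⟩ := Part.dom_iff_mem.1 hab
    obtain ⟨k, hk⟩ := Nat.Partrec.Code.evaln_complete.1 ((hmem a b s).1 hs)
    refine Nat.rfindOpt_dom.2 ⟨Nat.pair (Encodable.encode a) k, s, ?_⟩
    simp only [step, Nat.unpair_pair, Encodable.encodek, Option.bind_some]
    rw [Option.mem_def.1 hk, Option.bind_some, Encodable.encodek]
    rfl

/-- Free groups are projective: send each generator to a preimage of its image in `Γ`. -/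
theorem exists_lift_proj {Γ : Type*} [Group Γ] (X Y : Finset Γ)
    (hX : Subgroup.closure (X : Set Γ) = ⊤) :
    ∃ φ : FreeGroup Y →* FreeGroup X, ∀ u, proj X (φ u) = proj Y u := by
  have hsurj : Function.Surjective (proj X) := by
    rw [← MonoidHom.range_eq_top, proj, FreeGroup.range_lift_eq_closure]
    simpa using hX
  choose g hg using hsurj
  refine ⟨FreeGroup.lift fun y : Y => g y, fun u => ?_⟩
  refine DFunLike.congr_fun (f := (proj X).comp _) (FreeGroup.ext_hom _ _ fun y => ?_) u
  simpa [proj] using hg y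

end UBGen

open UBGen in
theorem mainTheorem7 {Γ : Type*} [Group Γ] (X Y : Finset Γ)
    (hX : Subgroup.closure (X : Set Γ) = ⊤) (hY : Subgroup.closure (Y : Set Γ) = ⊤)
    (h : UBGen.SolvableUBGenericWP X) : UBGen.SolvableUBGenericWP Y := by
  obtain ⟨S, hS, e, f, hf, hdom, hcorrect⟩ := h
  obtain ⟨φ, hφ⟩ := exists_lift_proj X Y hX
  obtain ⟨ψ, hψ⟩ := exists_lift_proj Y X hY
  obtain ⟨C, hC⟩ := wordLength_map_le φ
  let e' : Y ≃ Fin Y.card := Y.equivFin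
  -- for every parameter `w`, the element `t w v` has the same image in `Γ` as `v`
  let t : FreeGroup X → FreeGroup Y → FreeGroup X := fun w v => w * φ ((ψ w)⁻¹ * v)
  have ht : ∀ w v, proj X (t w v) = proj Y v := fun w v => by simp [t, hφ, hψ]
  have hcode : Primrec fun p : List (Fin X.card × Bool) × List (Fin Y.card × Bool) =>
      code e (t (word e p.1) (word e' p.2)) := by
    have h₁ := (primrec_code_inv e').comp ((primrec_code_map e e' ψ).comp
      (Primrec.fst (α := List (Fin X.card × Bool)) (β := List (Fin Y.card × Bool))))
    have h₂ := (primrec_code_map e' e φ).comp ((primrec_code_mul e').comp h₁ Primrec.snd)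
    refine ((primrec_code_mul e).comp Primrec.fst h₂).of_eq fun p => ?_
    simp [t, word_code]
  obtain ⟨F, hF, hFsound, hFdom⟩ := exists_partrec_dovetail (hf.comp hcode.to_comp)
  -- The whole halting set serves as the generic set, so only its genericity and the correctness of
  -- the answers remain.
  refine ⟨{v | (F (code e' v)).Dom}, ?_, e', F, hF, fun v hv => hv, ?_⟩
  · refine isUBGeneric_of_forall_ball fun n => ?_
    obtain ⟨w, hw⟩ := hS.exists_ball_subset (C * n)
    refine ⟨ψ w, ?_⟩
    rintro _ ⟨b, hb, rfl⟩
    -- With parameter `w`, the input `ψ(w) b` becomes `w φ(b)`, which lies in `w B_{Cn} ⊆ S`.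
    refine hFdom (code e w) _ (hdom _ ?_)
    simp only [word_code, t, smul_eq_mul, inv_mul_cancel_left]
    exact hw ⟨φ b, (hC b).trans (Nat.mul_le_mul_left C hb), rfl⟩
  · intro v b hb
    obtain ⟨L, hL⟩ := hFsound _ b hb
    rw [hcorrect _ b hL, MonoidHom.mem_ker, MonoidHom.mem_ker, ht, word_code]
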